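/- Words are finite or right-infinite sequences of letters. A formula is a finite collection of finite words (its fragments, separated by dots) over a set of variables; a ternary formula is a formula over the variables $A,B,C$. A morphism is non-erasing if the image of every letter is non-empty. An infinite word $w$ over $\{0,1,2\}$ avoids a formula $f$ if there is no non-erasing morphism $h$ from words over the variables to words over $\{0,1,2\}$ such that $h(\varphi)$ is a factor of $w$ for every fragment $\varphi$ of $f$. For formulas $f',f$, write $f'\preceq f$ if there is a non-erasing morphism $h$ such that, for every fragment $\varphi$ of $f'$, the word $h(\varphi)$ is a factor of some fragment of $f$. An infinite word is recurrent if each of its finite factors appears in it infinitely many times. Two infinite words are equivalent if they have the same set of finite factors. Let $b_5$ be the fixed point, starting with $0$, of the morphism $0\mapsto 01,\ 1\mapsto 23,\ 2\mapsto 4,\ 3\mapsto 21,\ 4\mapsto 0$, let $w_3$ be the image of $b_5$ under the morphism $0\mapsto 02,\ 1\mapsto 1,\ 2\mapsto 0,\ 3\mapsto 12,\ 4\mapsto\varepsilon$, and let $\sigma$ be the morphism $0\mapsto 1,\ 1\mapsto 2,\ 2\mapsto 0$. Theorem. Let $f$ be a ternary formula such that $$ABA.BCB.ACA\ \preceq\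 f\ \preceq\ ABA.ABCBA.ACA.ACB.BCA.$$ Then every recurrent infinite word over $\{0,1,2\}$ that avoids $f$ is equivalent to $w_3$, $\sigma(w_3)$ or $\sigma^2(w_3)$. -/

import Mathlib

/-- The word `u` occurs in the infinite word `w` at position `i`. -/
def OccursAt {α : Type*} (u : List α) (w : ℕ → α) (i : ℕ) : Prop :=
  ∀ (j : ℕ) (hj : j < u.length), u[j] = w (i + j)

/-- `u` is a (finite) factor of the right-infinite word `w`. -/
def IsFactor {α : Type*} (u : List α) (w : ℕ → α) : Prop :=
  ∃ i, OccursAt u w i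

/-- An infinite word is recurrent if each of its factors appears infinitely many times. -/
def Recurrent {α : Type*} (w : ℕ → α) : Prop :=
  ∀ u : List α, IsFactor u w → {i : ℕ | OccursAt u w i}.Infinite

/-- Two infinite words are equivalent if they have the same set of factors. -/
def WordEquiv {α : Type*} (w w' : ℕ → α) : Prop :=
  ∀ u : List α, IsFactor u w ↔ IsFactor u w'

/-- The morphism of free monoids with letter images `m`, applied to a finite word. -/
def applyMorphism {α β : Type*} (m : α → List β) (u : List α) : List β :=
  u.flatMap m

/-- A morphism is non-erasing if the image of every letter is non-empty. -/
def NonErasing {α β : Type*} (m : α → List β) : Prop :=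
  ∀ x, m x ≠ []

/-- A formula over the set of variables `V`, given by its list of fragments. -/
abbrev Formula (V : Type*) := List (List V)

/-- The infinite word `w` avoids the formula `f`: there is no non-erasing morphism under which
the image of every fragment of `f` is a factor of `w`. -/
def Avoids {V α : Type*} (w : ℕ → α) (f : Formula V) : Prop :=
  ¬ ∃ h : V → List α, NonErasing h ∧ ∀ φ ∈ f, IsFactor (applyMorphism h φ) w

/-- `Divides f' f` is `f' ⪯ f`: the formula `f` is divisible by `f'`, that is, there is a
non-erasing morphism under which the image of every fragment of `f'` is a factor of some
fragment of `f`. -/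
def Divides {V' V : Type*} (f' : Formula V') (f : Formula V) : Prop :=
  ∃ h : V' → List V, NonErasing h ∧ ∀ φ ∈ f', ∃ ψ ∈ f, applyMorphism h φ <:+: ψ

/-- The formula `ABA.BCB.ACA`, with `A = 0`, `B = 1`, `C = 2`. -/
def lowerFormula : Formula (Fin 3) :=
  [[0, 1, 0], [1, 2, 1], [0, 2, 0]]

/-- The formula `ABA.ABCBA.ACA.ACB.BCA`, with `A = 0`, `B = 1`, `C = 2`. -/
def upperFormula : Formula (Fin 3) :=
  [[0, 1, 0], [0, 1, 2, 1, 0], [0, 2, 0], [0, 2, 1], [1, 2, 0]]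

/-- The morphism `01/23/4/21/0`. -/
def morphB5 : Fin 5 → List (Fin 5) :=
  ![[0, 1], [2, 3], [4], [2, 1], [0]]

/-- The finite word obtained from `0` by applying `01/23/4/21/0` to it `n` times. -/
def iterB5 (n : ℕ) : List (Fin 5) :=
  (applyMorphism morphB5)^[n] [0]

/-- The fixed point `b₅` of `01/23/4/21/0`, the limit of the words `iterB5 n`. The default value
of `getD` is never used, see `iterB5_length` and `iterB5_occursAt`. -/
def b5 : ℕ → Fin 5 := fun i => (iterB5 i).getD i 0

/-- The morphism `02/1/0/12/ε`. -/
def morphM2 : Fin 5 → List (Fin 3) :=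
  ![[0, 2], [1], [0], [1, 2], []]

/-- The infinite word `w₃`, the image of `b₅` under `02/1/0/12/ε`, that is, the limit of the images
of the prefixes `iterB5 n` of `b₅`. The default value of `getD` is never used, see
`image_iterB5_length` and `image_b5_occursAt`. -/
def w3 : ℕ → Fin 3 := fun i => (applyMorphism morphM2 (iterB5 i)).getD i 0

/-- The cyclic permutation `1/2/0` of the three letters. -/
def sigma : Fin 3 → Fin 3 := ![1, 2, 0]

theorem applyMorphism_append {α β : Type*} (m : α → List β) (u v : List α) :
    applyMorphism m (u ++ v) = applyMorphism m u ++ applyMorphism m v := by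
  simp [applyMorphism]

theorem iterB5_succ (n : ℕ) : iterB5 (n + 1) = applyMorphism morphB5 (iterB5 n) := by
  simp [iterB5, Function.iterate_succ_apply']

/-- Each iterate extends the previous one by a word with a letter that `02/1/0/12/ε`
does not erase. -/
theorem iterB5_succ_eq_append (n : ℕ) : ∃ v : List (Fin 5),
    iterB5 (n + 1) = iterB5 n ++ v ∧ ∃ x ∈ v, x = 0 ∨ x = 1 ∨ x = 3 := by
  induction n with
  | zero => exact ⟨[1], by simp [iterB5, applyMorphism, morphB5], 1, by simp, by simp⟩
  | succ n ih =>
    obtain ⟨v, hv, x, hx, h⟩ := ih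
    refine ⟨applyMorphism morphB5 v, ?_, ?_⟩
    · rw [iterB5_succ (n + 1), hv, applyMorphism_append, ← hv, iterB5_succ]
    · rcases h with rfl | rfl | rfl
      · exact ⟨0, List.mem_flatMap.2 ⟨0, hx, by simp [morphB5]⟩, by simp⟩
      · exact ⟨3, List.mem_flatMap.2 ⟨1, hx, by simp [morphB5]⟩, by simp⟩
      · exact ⟨1, List.mem_flatMap.2 ⟨3, hx, by simp [morphB5]⟩, by simp⟩

theorem iterB5_prefix {m n : ℕ} (h : m ≤ n) : iterB5 m <+: iterB5 n := by
  induction n, h using Nat.le_induction with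
  | base => exact List.prefix_rfl
  | succ n _ ih =>
    obtain ⟨v, hv, -⟩ := iterB5_succ_eq_append n
    exact ih.trans ⟨v, hv.symm⟩

theorem iterB5_length (n : ℕ) : n < (iterB5 n).length := by
  induction n with
  | zero => simp [iterB5]
  | succ n ih =>
    obtain ⟨v, hv, x, hx, -⟩ := iterB5_succ_eq_append n
    have := List.length_pos_of_mem hx
    rw [hv, List.length_append]
    omega

theorem image_iterB5_length (n : ℕ) : n < (applyMorphism morphM2 (iterB5 n)).length := by
  induction n with
  | zero => simp [iterB5, applyMorphism, morphM2]
  | succ n ih =>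
    obtain ⟨v, hv, x, hx, h⟩ := iterB5_succ_eq_append n
    have : 0 < (applyMorphism morphM2 v).length := by
      have key : ∃ y, y ∈ morphM2 x := by
        rcases h with rfl | rfl | rfl
        · exact ⟨0, by simp [morphM2]⟩
        · exact ⟨1, by simp [morphM2]⟩
        · exact ⟨1, by simp [morphM2]⟩
      obtain ⟨y, hy⟩ := key
      exact List.length_pos_of_mem (List.mem_flatMap.2 ⟨x, hx, hy⟩)
    rw [hv, applyMorphism_append, List.length_append]
    omega

theorem getElem_eq_getD_of_prefix {α : Type*} {u v : List α} (d : α)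
    (h : u <+: v ∨ v <+: u) {i : ℕ} (hu : i < u.length) (hv : i < v.length) :
    u[i] = v.getD i d := by
  rw [List.getD_eq_getElem _ _ hv]
  rcases h with h | h
  · exact h.getElem hu
  · exact (h.getElem hv).symm

/-- Every iterate `iterB5 n` is a prefix of `b5`. -/
theorem iterB5_occursAt (n : ℕ) : OccursAt (iterB5 n) b5 0 := by
  intro j hj
  rw [Nat.zero_add]
  exact getElem_eq_getD_of_prefix 0 ((le_total n j).imp iterB5_prefix iterB5_prefix) hj
    (iterB5_length j)

/-- The image under `02/1/0/12/ε` of every prefix of `b5` is a prefix of `w3`. -/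
theorem image_b5_occursAt (u : List (Fin 5)) (hu : OccursAt u b5 0) :
    OccursAt (applyMorphism morphM2 u) w3 0 := by
  intro j hj
  rw [Nat.zero_add]
  have key : ∀ k, u.length ≤ k → u <+: iterB5 k := by
    intro k hk
    have hk' := iterB5_length k
    rw [List.prefix_iff_eq_take]
    refine List.ext_getElem (by simp; omega) fun i h1 h2 => ?_
    rw [List.getElem_take, hu i h1, iterB5_occursAt k i (by omega)]
  have mono : ∀ {a b : List (Fin 5)}, a <+: b →
      applyMorphism morphM2 a <+: applyMorphism morphM2 b := by
    rintro a b ⟨t, rfl⟩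
    exact ⟨_, (applyMorphism_append _ _ _).symm⟩
  have h1 := mono (key (max u.length j) (le_max_left _ _))
  have h2 := mono (iterB5_prefix (le_max_right u.length j))
  exact getElem_eq_getD_of_prefix 0 (List.prefix_or_prefix_of_prefix h1 h2) hj
    (image_iterB5_length j)

/-! By `hupper`, `w` avoids `ABA.ABCBA.ACA.ACB.BCA`, and recurrence then makes it square-free. If
`aba`, `bcb` and `aca` were all factors for distinct letters `a`, `b`, `c`, then `A, B, C ↦ a, b, c`
would realise the formula; hence, up to `sigma`, `w` contains neither 121 nor 212
(`exists_missing_pair`).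

A square-free word without 121 and 212 splits, from some position on, into the blocks 021012, 01,
02, 012, 021, the images of 0, ..., 4 under `morphM2` after the square of `morphB5`. The word `y` of
block names is `B5Like`, and this property passes to a preimage of `y` under `morphB5`, so
desubstitution never stops: for every `n`, a suffix of `w` is an image under `morphM2` after the
power `n + 3` of `morphB5`.

Every such block contains a prefix of `w3` of length more than `n`. Conversely, a factor of `w`
recurs in the suffix and, for large `n`, meets at most two consecutive blocks, whose names also form
a factor of `b5`. Both inclusions of factor sets follow (`Recurrent.wordEquiv_w3`). -/

/-- The factor of length `n` of `w` at position `i`. -/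
def window {α : Type*} (w : ℕ → α) (i n : ℕ) : List α :=
  (List.range n).map fun j => w (i + j)

/-! ### Factors, recurrence and square-freeness. -/

section Words

variable {α β : Type*} {w : ℕ → α}

@[simp] theorem window_length (i n : ℕ) : (window w i n).length = n := by simp [window]

theorem window_zero (i : ℕ) : window w i 0 = [] := by simp [window]

theorem window_succ (i n : ℕ) : window w i (n + 1) = window w i n ++ [w (i + n)] := by
  simp [window, List.range_succ]

theorem window_add (i m n : ℕ) : window w i (m + n) = window w i m ++ window w (i + m) n := by
  induction n with
  | zero => simp [window_zero]
  | succ n ih => rw [← Nat.add_assoc, window_succ, ih, window_succ, List.append_assoc, Nat.add_assoc]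

theorem window_cons (i n : ℕ) : window w i (n + 1) = w i :: window w (i + 1) n := by
  rw [Nat.add_comm, window_add, window_succ, window_zero]; simp

theorem occursAt_window (i n : ℕ) : OccursAt (window w i n) w i := by
  intro j hj; simp [window]

theorem occursAt_iff_window {u : List α} {i : ℕ} : OccursAt u w i ↔ window w i u.length = u := by
  refine ⟨fun h => List.ext_getElem (by simp) fun j h1 h2 => ?_, fun h => ?_⟩
  · rw [h j h2]; simp [window]
  · rw [← h]; exact occursAt_window _ _

theorem occursAt_append {u v : List α} {i : ℕ} :
    OccursAt (u ++ v) w i ↔ OccursAt u w i ∧ OccursAt v w (i + u.length) := by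
  simp only [occursAt_iff_window, List.length_append, window_add]
  exact ⟨fun h => List.append_inj h (by simp), fun h => by rw [h.1, h.2]⟩

theorem isFactor_window (i n : ℕ) : IsFactor (window w i n) w := ⟨i, occursAt_window i n⟩

theorem OccursAt.infix {u v : List α} {i : ℕ} (h : OccursAt v w i) (huv : u <:+: v) :
    ∃ j, i ≤ j ∧ OccursAt u w j := by
  obtain ⟨s, t, rfl⟩ := huv
  rw [occursAt_append, occursAt_append] at h
  exact ⟨_, Nat.le_add_right _ _, h.1.2⟩

theorem IsFactor.infix {u v : List α} (h : IsFactor v w) (huv : u <:+: v) : IsFactor u w := by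
  obtain ⟨i, hi⟩ := h
  obtain ⟨j, -, hj⟩ := hi.infix huv
  exact ⟨j, hj⟩

theorem Recurrent.exists_ge (hw : Recurrent w) {u : List α} (h : IsFactor u w) (n : ℕ) :
    ∃ i, n ≤ i ∧ OccursAt u w i := by
  obtain ⟨i, hi, hn⟩ := (hw u h).exists_gt n
  exact ⟨i, hn.le, hi⟩

/-- In a recurrent word, any two factors occur in this order in a common factor. -/
theorem Recurrent.link (hw : Recurrent w) {u v : List α} (hu : IsFactor u w) (hv : IsFactor v w) :
    ∃ z, z ≠ [] ∧ IsFactor (u ++ z ++ v) w := by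
  obtain ⟨i, hi⟩ := hu
  obtain ⟨j, hj, hv⟩ := hw.exists_ge hv (i + u.length + 1)
  obtain ⟨n, rfl⟩ := Nat.exists_eq_add_of_le hj
  refine ⟨window w (i + u.length) (n + 1), fun h => by simpa using congrArg List.length h, i, ?_⟩
  rw [occursAt_append, occursAt_append]
  refine ⟨⟨hi, occursAt_window _ _⟩, ?_⟩
  rwa [List.length_append, window_length,
    show i + (u.length + (n + 1)) = i + u.length + 1 + n by omega]

theorem applyMorphism_ne_nil {m : α → List β} (hm : NonErasing m) {u : List α} (hu : u ≠ []) :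
    applyMorphism m u ≠ [] := by
  obtain ⟨x, l, rfl⟩ := List.exists_cons_of_ne_nil hu
  simp [applyMorphism, hm x]

theorem applyMorphism_infix (m : α → List β) {u v : List α} (h : u <:+: v) :
    applyMorphism m u <:+: applyMorphism m v := by
  obtain ⟨s, t, rfl⟩ := h
  exact ⟨applyMorphism m s, applyMorphism m t, by simp only [applyMorphism_append]⟩

theorem applyMorphism_comp {γ : Type*} (m : α → List β) (m' : β → List γ) (u : List α) :
    applyMorphism (fun x => applyMorphism m' (m x)) u = applyMorphism m' (applyMorphism m u) := by
  simp [applyMorphism, List.flatMap_assoc]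

theorem Avoids.of_divides {V V' : Type*} {f' : Formula V'} {f : Formula V} (hw : Avoids w f')
    (h : Divides f' f) : Avoids w f := by
  rintro ⟨g, hg, hf⟩
  obtain ⟨h, hh, hd⟩ := h
  refine hw ⟨fun x => applyMorphism g (h x), fun x => applyMorphism_ne_nil hg (hh x),
    fun φ hφ => ?_⟩
  obtain ⟨ψ, hψ, hi⟩ := hd φ hφ
  rw [applyMorphism_comp]
  exact (hf ψ hψ).infix (applyMorphism_infix g hi)

/-- No non-empty square is a factor of `w`. -/
def SquareFree (w : ℕ → α) : Prop :=
  ∀ u : List α, u ≠ [] → ¬ IsFactor (u ++ u) w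

theorem Avoids.upperFormula (hw : Avoids w upperFormula) {a b c : List α} (ha : a ≠ [])
    (hb : b ≠ []) (hc : c ≠ []) (h1 : IsFactor (a ++ b ++ a) w)
    (h2 : IsFactor (a ++ b ++ c ++ b ++ a) w) (h3 : IsFactor (a ++ c ++ a) w)
    (h4 : IsFactor (a ++ c ++ b) w) (h5 : IsFactor (b ++ c ++ a) w) : False := by
  refine hw ⟨![a, b, c], fun x => by fin_cases x <;> assumption, ?_⟩
  simp only [List.append_assoc] at h1 h2 h3 h4 h5
  simpa [_root_.upperFormula, applyMorphism] using ⟨h1, h2, h3, h4, h5⟩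

/-- A square `aa` in a recurrent word yields `aazaa`, hence, with `b = aza`, an occurrence of
the formula. -/
theorem Recurrent.squareFree (hw : Recurrent w) (ha : Avoids w upperFormula) : SquareFree w := by
  intro a hne h
  obtain ⟨z, hz, h1⟩ := hw.link h h
  have h2 : IsFactor (a ++ a ++ z ++ a) w := h1.infix ⟨[], a, by simp⟩
  have h3 : IsFactor (a ++ z ++ a ++ a) w := h1.infix ⟨a, [], by simp⟩
  obtain ⟨c, hc, h4⟩ := hw.link h2 h3
  refine ha.upperFormula hne (b := a ++ z ++ a) (by simp [hne]) hc (by simpa using h1)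
    (by simpa using h4) (h4.infix ⟨a ++ a ++ z, z ++ a ++ a, by simp⟩)
    (h4.infix ⟨a ++ a ++ z, a, by simp⟩) (h4.infix ⟨a, z ++ a ++ a, by simp⟩)

end Words

/-! ### Backtracking search over square-free words. -/

section Search

variable {k : ℕ}

/-- Whether the reversal of `v` ends with a non-empty square or with a word of `forb`. -/
def badEnd (forb : List (List (Fin k))) (v : List (Fin k)) : Bool :=
  ((List.range v.length).any fun p =>
      p + 1 + (p + 1) ≤ v.length && v.take (p + 1) == (v.drop (p + 1)).take (p + 1)) ||
    forb.any fun f => f.reverse.isPrefixOf v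

/-- Whether `ok` holds for every extension of the reversal of `v` by `n` letters to the right
that creates neither a square nor a word of `forb`. -/
def allExtensions (forb : List (List (Fin k))) (ok : List (Fin k) → Bool) :
    ℕ → List (Fin k) → Bool
  | 0, v => ok v.reverse
  | n + 1, v => (List.finRange k).all fun x =>
      badEnd forb (x :: v) || allExtensions forb ok n (x :: v)

theorem badEnd_not_isFactor {forb : List (List (Fin k))} {w : ℕ → Fin k} (hw : SquareFree w)
    (hforb : ∀ f ∈ forb, ¬ IsFactor f w) {v : List (Fin k)} (hv : IsFactor v.reverse w) :
    badEnd forb v = false := by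
  rw [← Bool.not_eq_true]
  intro h
  simp only [badEnd, Bool.or_eq_true, List.any_eq_true, Bool.and_eq_true, decide_eq_true_eq,
    beq_iff_eq, List.isPrefixOf_iff_prefix] at h
  rcases h with ⟨p, -, hp, heq⟩ | ⟨f, hf, t, rfl⟩
  · refine hw (v.take (p + 1)).reverse ?_ (hv.infix ⟨((v.drop (p + 1)).drop (p + 1)).reverse, [], ?_⟩)
    · intro h
      have := congrArg List.length h
      rw [List.length_reverse, List.length_take, List.length_nil] at this
      omega
    · conv_rhs => rw [← List.take_append_drop (p + 1) v,
        ← List.take_append_drop (p + 1) (v.drop (p + 1)), ← heq]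
      simp
  · exact hforb f hf (hv.infix ⟨t.reverse, [], by simp⟩)

/-- The letters actually read in `w` never trigger `badEnd`, so they trace an unpruned branch of the
search tree, at whose leaf `ok` was tested. -/
theorem allExtensions_sound {forb : List (List (Fin k))} {w : ℕ → Fin k} (hw : SquareFree w)
    (hforb : ∀ f ∈ forb, ¬ IsFactor f w) {ok : List (Fin k) → Bool} {n : ℕ} :
    ∀ {v : List (Fin k)} {i : ℕ}, allExtensions forb ok n v = true → OccursAt v.reverse w i →
      ok (v.reverse ++ window w (i + v.length) n) = true := by
  induction n with
  | zero => intro v i h _; rw [allExtensions] at h; simpa [window_zero] using h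
  | succ n ih =>
    intro v i h hv
    rw [allExtensions, List.all_eq_true] at h
    have hx := h (w (i + v.length)) (List.mem_finRange _)
    have hocc : OccursAt (w (i + v.length) :: v).reverse w i := by
      rw [List.reverse_cons, occursAt_append]
      refine ⟨hv, fun j hj => ?_⟩
      obtain rfl : j = 0 := by simpa using hj
      simp
    rw [badEnd_not_isFactor hw hforb ⟨i, hocc⟩, Bool.false_or] at hx
    have := ih hx hocc
    rw [window_cons]
    simpa [Nat.add_assoc] using this

/-- With `ok` constantly false, a successful search means that every branch dies within `n` letters.
-/
theorem not_isFactor_of_allExtensions {forb : List (List (Fin k))} {w : ℕ → Fin k}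
    (hw : SquareFree w) (hforb : ∀ f ∈ forb, ¬ IsFactor f w) {n : ℕ} {u : List (Fin k)}
    (h : allExtensions forb (fun _ => false) n u.reverse = true) : ¬ IsFactor u w := by
  rintro ⟨i, hi⟩
  have := allExtensions_sound hw hforb h (i := i) (by rwa [List.reverse_reverse])
  simp at this

end Search

/-! ### Which palindromes of length three can occur. -/

section Ternary

variable {w : ℕ → Fin 3}

theorem SquareFree.succ_ne (hw : SquareFree w) (i : ℕ) : w i ≠ w (i + 1) := by
  intro h
  refine hw [w i] (by simp) ⟨i, ?_⟩
  simp [occursAt_iff_window, window_succ, window_zero, h]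

theorem SquareFree.not_alternating (hw : SquareFree w) {i : ℕ} (h1 : w i = w (i + 2))
    (h2 : w (i + 1) = w (i + 3)) : False := by
  refine hw [w i, w (i + 1)] (by simp) ⟨i, ?_⟩
  simp [occursAt_iff_window, window_succ, window_zero, h1, h2]

/-- If `acb` or `bca` is forbidden, `aca` has no square-free extension by 24 letters to the right.
-/
theorem SquareFree.isFactor_of_isFactor (hw : SquareFree w) {a b c : Fin 3} (hab : a ≠ b)
    (hac : a ≠ c) (hbc : b ≠ c) (h : IsFactor [a, c, a] w) :
    IsFactor [a, c, b] w ∧ IsFactor [b, c, a] w := by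
  have key : ∀ a b c : Fin 3, a ≠ b → a ≠ c → b ≠ c →
      allExtensions [[a, c, b]] (fun _ => false) 24 [a, c, a] = true ∧
        allExtensions [[b, c, a]] (fun _ => false) 24 [a, c, a] = true := by
    decide +kernel
  obtain ⟨k1, k2⟩ := key a b c hab hac hbc
  constructor <;> by_contra hn
  · exact not_isFactor_of_allExtensions hw (forb := [[a, c, b]]) (by simpa using hn)
      (u := [a, c, a]) k1 h
  · exact not_isFactor_of_allExtensions hw (forb := [[b, c, a]]) (by simpa using hn)
      (u := [a, c, a]) k2 h

/-- Square-freeness forces the letter `a` on both sides of `bcb`, which gives the fragment `ABCBA`;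
`acb` and `bca` come from `aca`. -/
theorem not_isFactor_palindromes (hrec : Recurrent w) (hw : Avoids w upperFormula) {a b c : Fin 3}
    (hab : a ≠ b) (hac : a ≠ c) (hbc : b ≠ c) (h1 : IsFactor [a, b, a] w)
    (h2 : IsFactor [b, c, b] w) (h3 : IsFactor [a, c, a] w) : False := by
  have hsq := hrec.squareFree hw
  obtain ⟨h4, h5⟩ := hsq.isFactor_of_isFactor hab hac hbc h3
  refine hw.upperFormula (a := [a]) (b := [b]) (c := [c]) (by simp) (by simp) (by simp) h1 ?_ h3 h4
    h5
  obtain ⟨i, hi, hocc⟩ := hrec.exists_ge h2 1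
  obtain ⟨i, rfl⟩ := Nat.exists_eq_add_of_le' hi
  have e0 : b = w (i + 1) := hocc 0 (by simp)
  have e1 : c = w (i + 2) := hocc 1 (by simp)
  have e2 : b = w (i + 3) := hocc 2 (by simp)
  have third : ∀ x : Fin 3, x ≠ b → x ≠ c → x = a := by
    intro x _ _
    omega
  have hl : w i = a := third _ (fun h => hsq.succ_ne i (h.trans e0))
    fun h => hsq.not_alternating (h.trans e1) (e0.symm.trans e2)
  have hr : w (i + 4) = a := third _ (fun h => hsq.succ_ne (i + 3) (e2.symm.trans h.symm))
    fun h => hsq.not_alternating (i := i + 1) (e0.symm.trans e2) (e1.symm.trans h.symm)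
  refine ⟨i, occursAt_iff_window.2 ?_⟩
  simp [window_succ, window_zero, hl, hr, ← e0, ← e1, ← e2]

/-- If each pair had a member in `w`, `not_isFactor_palindromes` would leave exactly 010, 121, 202
or exactly 101, 212, 020 as palindromic factors of length three. `c1` excludes the first set and
`c2` the second. -/
theorem exists_missing_pair (hrec : Recurrent w) (hw : Avoids w upperFormula) :
    (¬ IsFactor [1, 2, 1] w ∧ ¬ IsFactor [2, 1, 2] w) ∨
      (¬ IsFactor [2, 0, 2] w ∧ ¬ IsFactor [0, 2, 0] w) ∨
      (¬ IsFactor [0, 1, 0] w ∧ ¬ IsFactor [1, 0, 1] w) := by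
  have hsq := hrec.squareFree hw
  have c1 : IsFactor [0, 1, 0] w → IsFactor [0, 2, 0] w ∨ IsFactor [1, 0, 1] w ∨
      IsFactor [2, 1, 2] w := by
    intro h
    by_contra! hn
    exact not_isFactor_of_allExtensions hsq (forb := [[0, 2, 0], [1, 0, 1], [2, 1, 2]])
      (by simpa using hn) (n := 4) (u := [0, 1, 0]) (by decide +kernel) h
  have c2 : IsFactor [1, 0, 1] w → IsFactor [0, 1, 0] w ∨ IsFactor [1, 2, 1] w ∨
      IsFactor [2, 0, 2] w := by
    intro h
    by_contra! hn
    exact not_isFactor_of_allExtensions hsq (forb := [[0, 1, 0], [1, 2, 1], [2, 0, 2]])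
      (by simpa using hn) (n := 4) (u := [1, 0, 1]) (by decide +kernel) h
  have key : ∀ a b c : Fin 3, a ≠ b → a ≠ c → b ≠ c → IsFactor [a, b, a] w →
      IsFactor [b, c, b] w → ¬ IsFactor [a, c, a] w := fun a b c hab hac hbc h1 h2 h3 =>
    not_isFactor_palindromes hrec hw hab hac hbc h1 h2 h3
  have k1 := key 0 1 2 (by decide) (by decide) (by decide)
  have k2 := key 0 2 1 (by decide) (by decide) (by decide)
  have k3 := key 1 0 2 (by decide) (by decide) (by decide)
  have k4 := key 1 2 0 (by decide) (by decide) (by decide)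
  have k5 := key 2 0 1 (by decide) (by decide) (by decide)
  have k6 := key 2 1 0 (by decide) (by decide) (by decide)
  clear key hrec hw hsq
  generalize IsFactor [0, 1, 0] w = p1 at *
  generalize IsFactor [0, 2, 0] w = p2 at *
  generalize IsFactor [1, 0, 1] w = p3 at *
  generalize IsFactor [1, 2, 1] w = p4 at *
  generalize IsFactor [2, 0, 2] w = p5 at *
  generalize IsFactor [2, 1, 2] w = p6 at *
  grind

end Ternary

/-! ### Desubstitution by local decoding. -/

section Preimage

variable {α β γ : Type*}

/-- The image of `z` under `m` is the suffix of `w` that starts at position `i`. -/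
def Covers (m : β → List α) (z : ℕ → β) (w : ℕ → α) (i : ℕ) : Prop :=
  ∀ n, OccursAt (applyMorphism m (window z 0 n)) w i

theorem Covers.isFactor {m : β → List α} {z : ℕ → β} {w : ℕ → α} {i : ℕ} (h : Covers m z w i)
    {v : List β} (hv : IsFactor v z) : IsFactor (applyMorphism m v) w := by
  obtain ⟨j, hj⟩ := hv
  refine IsFactor.infix ⟨i, h (j + v.length)⟩ (applyMorphism_infix m ⟨window z 0 j, [], ?_⟩)
  rw [window_add, Nat.zero_add, occursAt_iff_window.1 hj, List.append_nil]

theorem Covers.comp {m : β → List α} {m' : α → List γ} {z : ℕ → β} {y : ℕ → α} {w : ℕ → γ}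
    {i j : ℕ} (h : Covers m z y i) (h' : Covers m' y w j) :
    ∃ k, Covers (fun x => applyMorphism m' (m x)) z w k := by
  -- The `i` letters of `y` skipped by `z` delay the start by the length of their image.
  refine ⟨j + (applyMorphism m' (window y 0 i)).length, fun n => ?_⟩
  have := h' (i + (applyMorphism m (window z 0 n)).length)
  rw [window_add, Nat.zero_add, occursAt_iff_window.1 (h n), applyMorphism_append,
    occursAt_append] at this
  rw [applyMorphism_comp]
  exact this.2

/-- Positions of a decoding of `w`, starting at `i`, with the letter `L j` read at `j`. -/
def cutPos (m : β → List α) (L : ℕ → β) (i : ℕ) : ℕ → ℕ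
  | 0 => i
  | n + 1 => cutPos m L i n + (m (L (cutPos m L i n))).length

/-- `S` is the set of cut positions: reading the letter at a cut leads to the next cut, so decoding
continues forever. -/
theorem exists_covers {m : β → List α} {w : ℕ → α} {S : ℕ → Prop} {L : ℕ → β}
    {R : β → β → Prop} (h : ∀ i, S i → OccursAt (m (L i)) w i ∧ S (i + (m (L i)).length) ∧
      R (L i) (L (i + (m (L i)).length))) {i : ℕ} (hi : S i) :
    ∃ z : ℕ → β, (∀ k, R (z k) (z (k + 1))) ∧ Covers m z w i := by
  have hS : ∀ n, S (cutPos m L i n) := by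
    intro n
    induction n with
    | zero => exact hi
    | succ n ih => exact (h _ ih).2.1
  refine ⟨fun n => L (cutPos m L i n), fun n => (h _ (hS n)).2.2, fun n => ?_⟩
  suffices OccursAt (applyMorphism m (window (fun n => L (cutPos m L i n)) 0 n)) w i ∧
      i + (applyMorphism m (window (fun n => L (cutPos m L i n)) 0 n)).length = cutPos m L i n
    from this.1
  induction n with
  | zero => simp [window_zero, applyMorphism, cutPos, OccursAt]
  | succ n ih =>
    rw [window_succ, applyMorphism_append, occursAt_append, List.length_append, ← Nat.add_assoc,
      ih.2, Nat.zero_add]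
    exact ⟨⟨ih.1, by simpa [applyMorphism] using (h _ (hS n)).1⟩,
      by simp [applyMorphism, cutPos]⟩

theorem window_drop_take {w : ℕ → α} {i n a b : ℕ} (h : a + b ≤ n) :
    ((window w i n).drop a).take b = window w (i + a) b := by
  obtain ⟨c, rfl⟩ := Nat.exists_eq_add_of_le h
  rw [window_add, window_add, List.append_assoc, List.drop_left' (by simp),
    List.take_left' (by simp)]

variable {k l : ℕ}

/-- One decoding step inside the word `t`: if its prefix of length `r` shows a cut at position `d`,
then the image of the letter read there follows, and next comes a cut with an admissible letter. -/
def stepOk (m : Fin l → List (Fin k)) (cut : List (Fin k) → Bool) (code : List (Fin k) → Fin l)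
    (R : Fin l → Fin l → Bool) (d r : ℕ) (t : List (Fin k)) : Bool :=
  let x := code (t.take r)
  let t' := (t.drop (m x).length).take r
  !cut (t.take r) ||
    ((m x).length + r ≤ t.length && (m x).isPrefixOf (t.drop d) && cut t' && R x (code t'))

/-- Decoding is local: `h` verifies one step on all admissible words of length `n`, and `h0`
provides a first cut. -/
theorem exists_covers_of_allExtensions {forb : List (List (Fin k))} {w : ℕ → Fin k}
    (hw : SquareFree w) (hforb : ∀ f ∈ forb, ¬ IsFactor f w) {m : Fin l → List (Fin k)}
    {cut : List (Fin k) → Bool} {code : List (Fin k) → Fin l} {R : Fin l → Fin l → Bool}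
    {d r n n' : ℕ} (hr : r ≤ n)
    (h : allExtensions forb (stepOk m cut code R d r) n [] = true)
    (h0 : allExtensions forb (fun t => (List.range n').any fun j =>
      cut ((t.drop j).take r)) (n' + r) [] = true) :
    ∃ i z, (∀ j, R (z j) (z (j + 1)) = true) ∧ Covers m z w i := by
  have start := allExtensions_sound hw hforb h0 (i := 0) (fun j hj => absurd hj (by simp))
  simp only [List.reverse_nil, List.nil_append, List.length_nil, Nat.add_zero, List.any_eq_true,
    List.mem_range] at start
  obtain ⟨i, hi, hcut⟩ := start
  rw [window_drop_take (by omega), Nat.zero_add] at hcut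
  -- A window starts `d` letters before its cut, so the images are read in `w` shifted by `d`.
  have step : ∀ j, cut (window w j r) = true →
      OccursAt (m (code (window w j r))) (fun p => w (d + p)) j ∧
        cut (window w (j + (m (code (window w j r))).length) r) = true ∧
        R (code (window w j r))
          (code (window w (j + (m (code (window w j r))).length) r)) = true := by
    intro j hj
    have := allExtensions_sound hw hforb h (i := j) (fun j hj => absurd hj (by simp))
    have htake : (window w j n).take r = window w j r := by
      simpa using window_drop_take (w := w) (i := j) (a := 0) (b := r) (n := n) (by omega)
    simp only [List.reverse_nil, List.nil_append, List.length_nil, Nat.add_zero, stepOk, htake, hj,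
      Bool.not_true, Bool.false_or, Bool.and_eq_true, decide_eq_true_eq, window_length,
      List.isPrefixOf_iff_prefix] at this
    obtain ⟨⟨⟨hl, hp⟩, hc⟩, hR⟩ := this
    rw [window_drop_take hl] at hc hR
    refine ⟨fun p hp' => ?_, hc, hR⟩
    rw [hp.getElem hp', List.getElem_drop]
    simp [window, Nat.add_left_comm]
  obtain ⟨z, hz⟩ := exists_covers (S := fun j => cut (window w j r) = true)
    (R := fun x y => R x y = true) step hcut
  refine ⟨d + i, z, hz.1, fun p q hq => ?_⟩
  rw [hz.2 p q hq, Nat.add_assoc]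

end Preimage

/-! ### Words that resemble `b5`, and their preimages. -/

/-- The pairs of letters that occur consecutively in `b5`. -/
def goodPair (a b : Fin 5) : Bool :=
  [[0, 1], [0, 4], [1, 0], [1, 2], [2, 1], [2, 3], [3, 0], [3, 4], [4, 2]].contains [a, b]

/-- The `n`-th power of the morphism `01/23/4/21/0`. -/
def powB5 (n : ℕ) (x : Fin 5) : List (Fin 5) :=
  (applyMorphism morphB5)^[n] [x]

theorem applyMorphism_powB5 (n : ℕ) (u : List (Fin 5)) :
    applyMorphism (powB5 n) u = (applyMorphism morphB5)^[n] u := by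
  induction n with
  | zero => exact List.flatMap_singleton' u
  | succ n ih =>
    have : powB5 (n + 1) = fun x => applyMorphism morphB5 (powB5 n x) := by
      funext x
      rw [powB5, powB5, Function.iterate_succ_apply']
    rw [Function.iterate_succ_apply', ← ih, ← applyMorphism_comp, this]

/-- The pairs of letters of `y` are those of `b5`, and the image of `y` under the square of
`01/23/4/21/0` contains no square with a letter that `02/1/0/12/ε` and its composition with
`01/23/4/21/0` do not erase. -/
structure B5Like (y : ℕ → Fin 5) : Prop where
  pair : ∀ i, goodPair (y i) (y (i + 1)) = true
  square : ∀ v, IsFactor v y → ∀ u, (∃ x ∈ u, x = 0 ∨ x = 1 ∨ x = 3) →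
    ¬ u ++ u <:+: applyMorphism (powB5 2) v

theorem B5Like.squareFree {y : ℕ → Fin 5} (hy : B5Like y) : SquareFree y := by
  intro u hu h
  refine hy.square _ h (applyMorphism (powB5 2) u) ?_ (by rw [applyMorphism_append])
  obtain ⟨x, l, rfl⟩ := List.exists_cons_of_ne_nil hu
  -- The first power would not do: it sends 2 to 4.
  have : ∀ x : Fin 5, ∃ z ∈ powB5 2 x, z = 0 ∨ z = 1 ∨ z = 3 := by decide
  obtain ⟨z, hz, h⟩ := this x
  exact ⟨z, List.mem_flatMap.2 ⟨x, by simp, hz⟩, h⟩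

/-- Words of length two that are no factors of `b5`, and further words whose images under the
square of `01/23/4/21/0` contain squares. -/
def forbiddenB5 : List (List (Fin 5)) :=
  [[0, 1, 2, 1, 0], [2, 3, 0, 4], [4, 2, 1, 2, 3]] ++
    (List.finRange 5).flatMap fun a =>
      ((List.finRange 5).filter fun b => !goodPair a b).map fun b => [a, b]

theorem B5Like.goodPair_of_isFactor {y : ℕ → Fin 5} (hy : B5Like y) {a b : Fin 5}
    (h : IsFactor [a, b] y) : goodPair a b = true := by
  obtain ⟨i, hi⟩ := h
  have h0 : a = y i := hi 0 (by simp)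
  have h1 : b = y (i + 1) := hi 1 (by simp)
  rw [h0, h1]
  exact hy.pair i

theorem B5Like.not_isFactor_of_mem {y : ℕ → Fin 5} (hy : B5Like y) :
    ∀ f ∈ forbiddenB5, ¬ IsFactor f y := by
  intro f hf h
  simp only [forbiddenB5, List.mem_append, List.mem_flatMap, List.mem_map, List.mem_filter] at hf
  rcases hf with hf | ⟨a, -, b, ⟨-, hab⟩, rfl⟩
  -- For example, 01210 has image 0123·421·0·421·0123, which contains the square of 4210.
  · have : ∀ f ∈ ([[0, 1, 2, 1, 0], [2, 3, 0, 4], [4, 2, 1, 2, 3]] : List (List (Fin 5))),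
        ∃ u ∈ ([[4, 2, 1, 0], [2, 3, 0, 1], [1, 0, 4, 2]] : List (List (Fin 5))),
          (∃ x ∈ u, x = 0 ∨ x = 1 ∨ x = 3) ∧ u ++ u <:+: applyMorphism (powB5 2) f := by
      decide +kernel
    obtain ⟨u, -, hu, hi⟩ := this f hf
    exact hy.square f h u hu hi
  · simp [hy.goodPair_of_isFactor h] at hab

/-- The preimage letter of the block `01`, `23`, `4`, `21` or `0` that starts at the second letter
of a word. -/
def codeB5 (t : List (Fin 5)) : Fin 5 :=
  if [0, 1].isPrefixOf t.tail then 0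
  else if [2, 3].isPrefixOf t.tail then 1
  else if [4].isPrefixOf t.tail then 2
  else if [2, 1].isPrefixOf t.tail then 3
  else 4

/-- Whether a block `01`, `23`, `4`, `21` or `0` starts at the second letter of a word. -/
def cutB5 (t : List (Fin 5)) : Bool :=
  [0].isPrefixOf t.tail || [2].isPrefixOf t.tail || [4].isPrefixOf t.tail

theorem B5Like.exists_preimage {y : ℕ → Fin 5} (hy : B5Like y) :
    ∃ i z, B5Like z ∧ Covers morphB5 z y i := by
  -- Cuts precede each 0, 2 and 4. The long forbidden words exclude the preimage pairs 03, 14 and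
  -- 31: 01·21 must continue to 01210, 23·0 followed by 4 is 2304, and 21·23 must be preceded by 4.
  -- The last case needs the left context `d = 1`.
  obtain ⟨i, z, hz, hc⟩ := exists_covers_of_allExtensions hy.squareFree hy.not_isFactor_of_mem
    (m := morphB5) (cut := cutB5) (code := codeB5) (R := goodPair) (d := 1) (r := 3) (n := 7)
    (n' := 2) (by norm_num) (by decide +kernel) (by decide +kernel)
  refine ⟨i, z, ⟨hz, fun v hv u hu hi => hy.square _ (hc.isFactor hv) (applyMorphism morphB5 u) ?_
    ?_⟩, hc⟩
  -- The set of letters 0, 1, 3 is chosen so that the condition on `u` survives `morphB5`.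
  · have : ∀ x : Fin 5, (x = 0 ∨ x = 1 ∨ x = 3) → ∃ z ∈ morphB5 x, z = 0 ∨ z = 1 ∨ z = 3 := by
      decide
    obtain ⟨x, hx, h⟩ := hu
    obtain ⟨z, hz, h⟩ := this x h
    exact ⟨z, List.mem_flatMap.2 ⟨x, hx, hz⟩, h⟩
  · rw [applyMorphism_powB5, ← Function.iterate_succ_apply, Function.iterate_succ_apply',
      ← applyMorphism_append, ← applyMorphism_powB5]
    exact applyMorphism_infix _ hi

theorem powB5_add (m n : ℕ) (x : Fin 5) :
    powB5 (m + n) x = applyMorphism (powB5 m) (powB5 n x) := by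
  rw [applyMorphism_powB5, powB5, powB5, Function.iterate_add_apply]

theorem B5Like.exists_covers_powB5 {y : ℕ → Fin 5} (hy : B5Like y) (n : ℕ) :
    ∃ i z, B5Like z ∧ Covers (powB5 n) z y i := by
  induction n with
  | zero =>
    refine ⟨0, y, hy, fun n => ?_⟩
    rw [applyMorphism_powB5]
    exact occursAt_window 0 n
  | succ n ih =>
    obtain ⟨i, z, hz, hc⟩ := ih
    obtain ⟨j, z', hz', hc'⟩ := hz.exists_preimage
    obtain ⟨k, hk⟩ := hc'.comp hc
    refine ⟨k, z', hz', ?_⟩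
    have : powB5 (n + 1) = fun x => applyMorphism (powB5 n) (morphB5 x) := by
      funext x
      rw [powB5_add]
      simp [powB5, applyMorphism]
    rwa [this]

/-- The letter of `b5` whose image under the composition of `02/1/0/12/ε` with the square of
`01/23/4/21/0` starts at the fourth letter of a word. -/
def codeM2 (t : List (Fin 3)) : Fin 5 :=
  if [0, 2, 1, 0, 1, 2].isPrefixOf (t.drop 3) then 0
  else if [0, 2, 1].isPrefixOf (t.drop 3) then 4
  else if [0, 2].isPrefixOf (t.drop 3) then 2
  else if [0, 1, 2].isPrefixOf (t.drop 3) then 3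
  else 1

/-- Whether the fourth letter of a word is a `0` that is not the second one of `021012`. -/
def cutM2 (t : List (Fin 3)) : Bool :=
  [0].isPrefixOf (t.drop 3) && !([0, 2, 1, 0, 1, 2].isPrefixOf t)

theorem SquareFree.exists_b5Like {w : ℕ → Fin 3} (hw : SquareFree w)
    (h1 : ¬ IsFactor [1, 2, 1] w) (h2 : ¬ IsFactor [2, 1, 2] w) :
    ∃ i y, B5Like y ∧ Covers (fun x => applyMorphism morphM2 (powB5 2 x)) y w i := by
  -- Blocks start at the zeros, except that 021 and a following 012 merge into one block. The three
  -- letters of left context recognise the inner zero of 021012; `r = 3 + 6` also shows the longest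
  -- block, and `n = 6 + 9` the window after it.
  obtain ⟨i, z, hz, hc⟩ := exists_covers_of_allExtensions hw (forb := [[1, 2, 1], [2, 1, 2]])
    (by simp [h1, h2]) (m := fun x => applyMorphism morphM2 (powB5 2 x)) (cut := cutM2)
    (code := codeM2) (R := goodPair) (d := 3) (r := 9) (n := 15) (n' := 7) (by norm_num)
    (by decide +kernel) (by decide +kernel)
  refine ⟨i, z, ⟨hz, fun v hv u hu hi => ?_⟩, hc⟩
  refine hw (applyMorphism morphM2 u) ?_ (IsFactor.infix (hc.isFactor hv) ?_)
  · have : ∀ x : Fin 5, (x = 0 ∨ x = 1 ∨ x = 3) → morphM2 x ≠ [] := by decide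
    obtain ⟨x, hx, h⟩ := hu
    intro hnil
    exact this x h (List.flatMap_eq_nil_iff.1 hnil x hx)
  · rw [applyMorphism_comp, ← applyMorphism_append]
    exact applyMorphism_infix _ hi

theorem iterB5_eq_powB5 (n : ℕ) : iterB5 n = powB5 n 0 := rfl

theorem applyMorphism_powB5_iterB5 (m n : ℕ) :
    applyMorphism (powB5 m) (iterB5 n) = iterB5 (m + n) := by
  rw [iterB5_eq_powB5, iterB5_eq_powB5, powB5_add]

theorem iterB5_infix_powB5 (n : ℕ) (a : Fin 5) : iterB5 n <:+: powB5 (n + 3) a := by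
  -- The exponent 3 is needed for the letter 1: 1, 23, 421, 0423.
  have h : ∀ a : Fin 5, [0] <:+: powB5 3 a := by decide
  rw [powB5_add, show iterB5 n = applyMorphism (powB5 n) [0] by
    simp [applyMorphism, iterB5_eq_powB5]]
  exact applyMorphism_infix _ (h a)

/-! ### Comparison of factors with `w3`. -/

section Covering

variable {α β : Type*}

theorem OccursAt.infix_of_le {w : ℕ → α} {u v : List α} {i j : ℕ} (hv : OccursAt v w i)
    (hu : OccursAt u w (i + j)) (h : j + u.length ≤ v.length) : u <:+: v := by
  rw [occursAt_iff_window] at hu hv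
  rw [← hu, ← window_drop_take h, hv]
  exact (List.take_prefix _ _).isInfix.trans (List.drop_suffix _ _).isInfix

/-- A word that is not longer than any letter image and occurs in an image occurs in the image of
at most two consecutive letters. -/
theorem exists_infix_of_infix_applyMorphism {g : β → List α} {u : List α}
    (hg : ∀ x, u.length ≤ (g x).length) {l : List β} (h : u <:+: applyMorphism g l) :
    ∃ p, p <:+: l ∧ p.length ≤ 2 ∧ u <:+: applyMorphism g p := by
  induction l with
  | nil => exact ⟨[], List.infix_rfl, by simp, h⟩
  | cons a l ih =>
    rw [show applyMorphism g (a :: l) = g a ++ applyMorphism g l by simp [applyMorphism],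
      List.infix_append_iff] at h
    rcases h with h | h | ⟨s, t, rfl, hs, ht⟩
    · exact ⟨[a], ⟨[], l, by simp⟩, by simp, by simpa [applyMorphism] using h⟩
    · obtain ⟨p, hp, hp', hu⟩ := ih h
      exact ⟨p, hp.trans (List.suffix_cons a l).isInfix, hp', hu⟩
    · cases l with
      | nil =>
        obtain rfl : t = [] := by simpa [applyMorphism] using ht
        exact ⟨[a], List.infix_rfl, by simp, by simpa [applyMorphism] using hs.isInfix⟩
      | cons b l =>
        refine ⟨[a, b], ⟨[], l, by simp⟩, by simp, ?_⟩
        rw [show applyMorphism g (b :: l) = g b ++ applyMorphism g l by simp [applyMorphism]] at ht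
        have hlen := hg b
        rw [List.length_append] at hlen
        have ht' : t <+: g b :=
          List.prefix_of_prefix_length_le ht (List.prefix_append _ _) (by omega)
        rw [show applyMorphism g [a, b] = g a ++ g b by simp [applyMorphism],
          List.infix_append_iff]
        exact Or.inr (Or.inr ⟨s, t, rfl, hs, ht'⟩)

end Covering

theorem B5Like.infix_iterB5 {y : ℕ → Fin 5} (hy : B5Like y) {p : List (Fin 5)}
    (hp : IsFactor p y) (hlen : p.length ≤ 2) : p <:+: iterB5 6 := by
  have h1 : ∀ a : Fin 5, [a] <:+: iterB5 6 := by decide +kernel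
  have h2 : ∀ a b : Fin 5, goodPair a b = true → [a, b] <:+: iterB5 6 := by decide +kernel
  match p, hlen with
  | [], _ => exact List.nil_infix
  | [a], _ => exact h1 a
  | [a, b], _ => exact h2 a b (hy.goodPair_of_isFactor hp)

theorem image_iterB5_isFactor (n : ℕ) : IsFactor (applyMorphism morphM2 (iterB5 n)) w3 :=
  ⟨0, image_b5_occursAt _ (iterB5_occursAt n)⟩

theorem Recurrent.wordEquiv_w3 {w : ℕ → Fin 3} (hrec : Recurrent w) (hw : SquareFree w)
    (h1 : ¬ IsFactor [1, 2, 1] w) (h2 : ¬ IsFactor [2, 1, 2] w) : WordEquiv w w3 := by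
  obtain ⟨i, y, hy, hc⟩ := hw.exists_b5Like h1 h2
  have covers : ∀ n, ∃ k z, B5Like z ∧
      Covers (fun x => applyMorphism morphM2 (powB5 (n + 3) x)) z w k := by
    intro n
    obtain ⟨j, z, hz, hc'⟩ := hy.exists_covers_powB5 (n + 1)
    obtain ⟨k, hk⟩ := hc'.comp hc
    refine ⟨k, z, hz, ?_⟩
    simpa only [applyMorphism_comp, ← powB5_add, show 2 + (n + 1) = n + 3 by omega] using hk
  have hinf : ∀ n a,
      applyMorphism morphM2 (iterB5 n) <:+: applyMorphism morphM2 (powB5 (n + 3) a) :=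
    fun n a => applyMorphism_infix _ (iterB5_infix_powB5 n a)
  intro u
  constructor
  · intro hu
    obtain ⟨k, z, hz, hk⟩ := covers u.length
    have hg : ∀ a, u.length < (applyMorphism morphM2 (powB5 (u.length + 3) a)).length := fun a =>
      (image_iterB5_length _).trans_le (hinf _ a).length_le
    obtain ⟨j, hj, hocc⟩ := hrec.exists_ge hu k
    obtain ⟨j, rfl⟩ := Nat.exists_eq_add_of_le hj
    -- No block is empty, so the first `j + u.length` blocks reach past the chosen occurrence of
    -- `u`.
    have hlen : ∀ l : List (Fin 5), l.length ≤
        (applyMorphism (fun x => applyMorphism morphM2 (powB5 (u.length + 3) x)) l).length := by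
      intro l
      induction l with
      | nil => simp
      | cons a l ih =>
        have := hg a
        simp only [applyMorphism, List.flatMap_cons, List.length_append, List.length_cons] at *
        omega
    have hX := (hk (j + u.length)).infix_of_le hocc (by simpa using hlen (window z 0 (j + u.length)))
    obtain ⟨p, hp, hp2, hup⟩ := exists_infix_of_infix_applyMorphism (fun a => (hg a).le) hX
    have := hz.infix_iterB5 ((isFactor_window _ _).infix hp) hp2
    have := hup.trans (applyMorphism_infix _ this)
    rw [applyMorphism_comp, applyMorphism_powB5_iterB5] at this
    exact (image_iterB5_isFactor _).infix this
  · rintro ⟨j, hj⟩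
    obtain ⟨k, z, hz, hk⟩ := covers (j + u.length)
    have := hk.isFactor (isFactor_window 0 1)
    rw [window_succ, window_zero] at this
    refine this.infix (List.IsInfix.trans ?_ ((hinf (j + u.length) (z 0)).trans
      (by simp [applyMorphism])))
    exact (image_b5_occursAt _ (iterB5_occursAt (j + u.length))).infix_of_le (by simpa using hj)
      (image_iterB5_length _).le

/-! ### Permuting the letters, and the conclusion. -/

section Sigma

theorem isFactor_comp_iff {α β : Type*} {g : α → β} {w : ℕ → α} {u : List β} :
    IsFactor u (fun i => g (w i)) ↔ ∃ v, v.map g = u ∧ IsFactor v w := by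
  constructor
  · rintro ⟨i, hi⟩
    refine ⟨window w i u.length, ?_, isFactor_window _ _⟩
    rw [occursAt_iff_window] at hi
    conv_rhs => rw [← hi]
    simp [window]
  · rintro ⟨v, rfl, i, hi⟩
    exact ⟨i, fun j hj => by simp [hi j (by simpa using hj)]⟩

theorem WordEquiv.comp {α β : Type*} {v w : ℕ → α} (h : WordEquiv v w) (g : α → β) :
    WordEquiv (fun i => g (v i)) (fun i => g (w i)) := by
  intro u
  simp only [isFactor_comp_iff, h _]

theorem Recurrent.comp {α β : Type*} {w : ℕ → α} (h : Recurrent w) (g : α → β) :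
    Recurrent fun i => g (w i) := by
  intro u hu
  obtain ⟨v, rfl, hv⟩ := isFactor_comp_iff.1 hu
  exact (h v hv).mono fun i hi j hj => by simp [hi j (by simpa using hj)]

theorem sigma_sigma_sigma (x : Fin 3) : sigma (sigma (sigma x)) = x := by
  revert x; decide

theorem IsFactor.map {α β : Type*} {w : ℕ → α} {u : List α} (h : IsFactor u w) (g : α → β) :
    IsFactor (u.map g) (fun i => g (w i)) :=
  isFactor_comp_iff.2 ⟨u, rfl, h⟩

theorem IsFactor.of_sigma {w : ℕ → Fin 3} {u : List (Fin 3)}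
    (h : IsFactor u fun i => sigma (w i)) : IsFactor (u.map fun x => sigma (sigma x)) w := by
  simpa only [sigma_sigma_sigma] using h.map fun x => sigma (sigma x)

theorem SquareFree.sigma {w : ℕ → Fin 3} (hw : SquareFree w) :
    SquareFree fun i => sigma (w i) := by
  intro u hu h
  have := h.of_sigma
  rw [List.map_append] at this
  exact hw _ (by simpa using hu) this

end Sigma

theorem mainTheorem5 (f : Formula (Fin 3))
    (hlower : Divides lowerFormula f) (hupper : Divides f upperFormula)
    (w : ℕ → Fin 3) (hrec : Recurrent w) (havoid : Avoids w f) :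
    WordEquiv w w3 ∨
      WordEquiv w (fun i => sigma (w3 i)) ∨
      WordEquiv w (fun i => sigma (sigma (w3 i))) := by
  have hu := havoid.of_divides hupper
  have hsq := hrec.squareFree hu
  rcases exists_missing_pair hrec hu with ⟨h1, h2⟩ | ⟨h1, h2⟩ | ⟨h1, h2⟩
  · exact Or.inl (hrec.wordEquiv_w3 hsq h1 h2)
  -- Applying `sigma` twice turns 202 and 020 into 121 and 212; a third application recovers `w`.
  · have := ((hrec.comp sigma).comp sigma).wordEquiv_w3 hsq.sigma.sigma
      (fun h => h1 (by simpa [sigma] using h.of_sigma.of_sigma))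
      (fun h => h2 (by simpa [sigma] using h.of_sigma.of_sigma))
    simpa only [sigma_sigma_sigma] using Or.inr (Or.inl (this.comp sigma))
  · have := (hrec.comp sigma).wordEquiv_w3 hsq.sigma
      (fun h => h1 (by simpa [sigma] using h.of_sigma))
      (fun h => h2 (by simpa [sigma] using h.of_sigma))
    simpa only [sigma_sigma_sigma] using
      Or.inr (Or.inr ((this.comp sigma).comp sigma))
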